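/- **Theorem 1.1.** Let $n\ge 0$ be an integer, let $X_1,\dots,X_n$ be independent (not necessarily identically distributed) random variables with values in a Polish space $\mathcal X$, and let $\mathcal S$ be a nonempty countable class of measurable functions $s=(s^1,\dots,s^n):\mathcal X\to[-1,1]^n$. Suppose that $\mathbb E(s^k(X_k))=0$ for every $s\in\mathcal S$ and every $k\in\{1,\dots,n\}$. Put $$S_n(s)=s^1(X_1)+\dots+s^n(X_n),\qquad Z=\sup_{s\in\mathcal S}S_n(s),\qquad V_n=\sup_{s\in\mathcal S}\operatorname{Var}S_n(s),$$ $$L(t)=\log\mathbb E(e^{tZ}),\qquad v=2\,\mathbb E(Z)+V_n .$$ Then $v\ge 0$, and the following hold. (a) For every $t>0$, $$L(t)\le t\,\mathbb E(Z)+\frac t2\bigl(2\,\mathbb E(Z)+V_n\bigr)\Bigl(\exp\bigl((e^{2t}-1)/2\bigr)-1\Bigr).$$ (b) For every $x>0$, $$\mathbb P\bigl(Z\ge\mathbb E(Z)+x\bigr)\le\exp\Bigl(-\frac x4\log\bigl(1+2\log(1+x/v)\bigr)\Bigr),$$ where, if $v=0$, the right-hand side is read as $0$. (c) For every $x>0$,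 $$\mathbb P\bigl(Z\ge\mathbb E(Z)+x\bigr)\le\exp\Bigl(-\frac{x^2}{v+\sqrt{v^2+3vx}+3x/2}\Bigr)\le\exp\Bigl(-\frac{x^2}{2v+3x}\Bigr).$$ -/

import Mathlib

open MeasureTheory ProbabilityTheory

namespace EmpiricalProcess

variable {Ω 𝒳 : Type*} {n : ℕ}

/-- The partial sum `S_n(s) = s¹(X₁) + ⋯ + sⁿ(X_n)` at the outcome `ω`,
where `s x k` is the `k`-th coordinate of `s x`. -/
noncomputable def partialSum (X : Fin n → Ω → 𝒳) (s : 𝒳 → Fin n → ℝ) (ω : Ω) : ℝ :=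
  ∑ k, s (X k ω) k

/-- The maximum `Z = sup {S_n(s) : s ∈ S}` of the empirical process. For a nonempty class of
functions with values in `[-1, 1]ⁿ` this is the supremum of a nonempty subset of `[-n, n]`. -/
noncomputable def maximum (X : Fin n → Ω → 𝒳) (S : Set (𝒳 → Fin n → ℝ)) (ω : Ω) : ℝ :=
  ⨆ s : S, partialSum X s.1 ω

/-- The maximal variance `V_n = sup {Var S_n(s) : s ∈ S}`. For a nonempty class of measurable
functions with values in `[-1, 1]ⁿ` this is the supremum of a nonempty subset of `[0, n²]`. -/
noncomputable def maxVariance [MeasurableSpace Ω] (μ : Measure Ω) (X : Fin n → Ω → 𝒳)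
    (S : Set (𝒳 → Fin n → ℝ)) : ℝ :=
  ⨆ s : S, Var[partialSum X s.1; μ]

/-- The variance factor `v = 2 E(Z) + V_n`. -/
noncomputable def varianceFactor [MeasurableSpace Ω] (μ : Measure Ω) (X : Fin n → Ω → 𝒳)
    (S : Set (𝒳 → Fin n → ℝ)) : ℝ :=
  2 * (∫ ω, maximum X S ω ∂μ) + maxVariance μ X S

end EmpiricalProcess

namespace EmpiricalProcess

/-! The argument is the entropy method. Let F = exp (tZ) on the product of the laws of the X_k. By
`entropy_pi_le`, Ent F is at most D, the sum over k of E[F log (F / E_k F)], where E_k averages over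
the coordinate k alone.

For a fixed k, let U = E_k F and let c be S_n(s) without its k-th term. Centring gives log U ≥ tc
for every s, so log (F / U) ≤ t. Write F as the excess F - exp (t S_n(s)) plus exp (t S_n(s)): this
bound handles the excess, Young's inequality the rest. The result, `entropy_le_of_exp_le`, bounds
the entropy along k by tU(log U - tc + (t/2) Var s^k(X_k)), for any s.

Since Z moves by at most 2 with one coordinate, U ≤ exp (2t) F. So s may be chosen at each point as
a near-maximizer of S_n; summing over k turns the brackets into log F + tV/2 - ∑ log (F / E_k F)
(`sum_coord_entropy_le`). After integration D reappears with a minus sign, and Ent F ≤ D leaves tL'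
- L ≤ t exp (2t) (L + tV/2) (`entropy_exp_supSum_le`). An integrating factor yields (a)
(`le_of_mul_deriv_sub_le`), and Chernoff's bound with explicit t yields (b) and (c). -/

/-- Young's inequality for the dual pair `x log x - x`, `exp`. -/
lemma mul_log_le_mul_log_add {x z : ℝ} (hx : 0 < x) (hz : 0 < z) :
    x * Real.log z ≤ x * Real.log x - x + z := by
  have h := Real.log_le_sub_one_of_pos (div_pos hz hx)
  rw [Real.log_div hz.ne' hx.ne'] at h
  have h2 := mul_le_mul_of_nonneg_left h hx.le
  have h3 : x * (z / x - 1) = z - x := by field_simp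
  linarith

/-! ### Duality formula for the entropy -/

section Bounded

variable {α : Type*} [MeasurableSpace α] {μ : Measure α} [IsProbabilityMeasure μ]

lemma integrable_of_mem_Icc {f : α → ℝ} {a b : ℝ} (hf : Measurable f)
    (h : ∀ x, f x ∈ Set.Icc a b) : Integrable f μ :=
  Integrable.of_mem_Icc a b hf.aemeasurable (ae_of_all _ h)

lemma integral_mem_Icc {f : α → ℝ} {a b : ℝ} (hf : Measurable f)
    (h : ∀ x, f x ∈ Set.Icc a b) : ∫ x, f x ∂μ ∈ Set.Icc a b := by
  have hi := integrable_of_mem_Icc (μ := μ) hf h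
  constructor
  · simpa using integral_mono (integrable_const a) hi fun x => (h x).1
  · simpa using integral_mono hi (integrable_const b) fun x => (h x).2

lemma integrable_mul_log {f g : α → ℝ} {a b : ℝ} (ha : 0 < a) (hf : Measurable f)
    (hg : Measurable g) (hfab : ∀ x, f x ∈ Set.Icc a b) (hgab : ∀ x, g x ∈ Set.Icc a b) :
    Integrable (fun x => f x * Real.log (g x)) μ := by
  refine (integrable_of_mem_Icc (μ := μ) hf hfab).mul_bdd
    (c := max |Real.log a| |Real.log b|) (hg.log.aestronglyMeasurable) (ae_of_all _ fun x => ?_)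
  rw [Real.norm_eq_abs]
  refine abs_le_max_abs_abs (Real.log_le_log ha (hgab x).1)
    (Real.log_le_log (ha.trans_le (hgab x).1) (hgab x).2)

/-- The duality formula for the entropy. -/
lemma integral_mul_log_sub_le_entropy {f g : α → ℝ} {a b : ℝ} (ha : 0 < a) (hf : Measurable f)
    (hg : Measurable g) (hfab : ∀ x, f x ∈ Set.Icc a b) (hgab : ∀ x, g x ∈ Set.Icc a b) :
    ∫ x, f x * Real.log (g x) ∂μ - (∫ x, f x ∂μ) * Real.log (∫ x, g x ∂μ) ≤
      ∫ x, f x * Real.log (f x) ∂μ - (∫ x, f x ∂μ) * Real.log (∫ x, f x ∂μ) := by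
  have hF := ha.trans_le (integral_mem_Icc (μ := μ) hf hfab).1
  have hG := ha.trans_le (integral_mem_Icc (μ := μ) hg hgab).1
  have hfi := integrable_of_mem_Icc (μ := μ) hf hfab
  have hgi := integrable_of_mem_Icc (μ := μ) hg hgab
  have hfg := integrable_mul_log (μ := μ) ha hf hg hfab hgab
  have hff := integrable_mul_log (μ := μ) ha hf hf hfab hfab
  set F := ∫ x, f x ∂μ
  set G := ∫ x, g x ∂μ
  -- Young's inequality with z = g · F/G: this rescaling of g has the same integral as f, so the
  -- terms -f + z integrate to zero.
  have key : ∀ x, f x * Real.log (g x) + f x * (Real.log F - Real.log G) ≤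
      f x * Real.log (f x) - f x + g x * (F / G) := by
    intro x
    have hgx := ha.trans_le (hgab x).1
    have h := mul_log_le_mul_log_add (ha.trans_le (hfab x).1) (mul_pos hgx (div_pos hF hG))
    rw [Real.log_mul hgx.ne' (div_pos hF hG).ne', Real.log_div hF.ne' hG.ne'] at h
    linarith
  have h := integral_mono (hfg.add (hfi.mul_const _)) ((hff.sub hfi).add (hgi.mul_const _)) key
  rw [integral_add' hfg (hfi.mul_const _), integral_add' (hff.sub hfi) (hgi.mul_const _),
    integral_sub' hff hfi, integral_mul_const, integral_mul_const] at h
  have h3 : G * (F / G) = F := by field_simp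
  change _ ≤ _ - F + G * (F / G) at h
  change _ + F * _ ≤ _ at h
  rw [h3] at h
  linarith

end Bounded

/-! ### Tensorization of the entropy on product spaces -/

section Tensorization

variable {ι : Type*} [DecidableEq ι] {E : ι → Type*} [∀ i, MeasurableSpace (E i)]

/-- The mean of `F` with respect to its `k`-th coordinate. -/
noncomputable def coordMean (ν : ∀ i, Measure (E i)) (k : ι) (F : (∀ i, E i) → ℝ)
    (x : ∀ i, E i) : ℝ :=
  ∫ y, F (Function.update x k y) ∂ν k

variable {ν : ∀ i, Measure (E i)}

lemma coordMean_update (k : ι) (F : (∀ i, E i) → ℝ) (x : ∀ i, E i) (y : E k) :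
    coordMean ν k F (Function.update x k y) = coordMean ν k F x := by
  simp [coordMean]

lemma coordMean_mul_const_coord (k : ι) (F : (∀ i, E i) → ℝ) {H : (∀ i, E i) → ℝ}
    (hH : ∀ x y, H (Function.update x k y) = H x) :
    coordMean ν k (fun x => F x * H x) = fun x => coordMean ν k F x * H x := by
  ext x
  simp only [coordMean, hH, integral_mul_const]

lemma dependsOn_coordMean (k : ι) {F : (∀ i, E i) → ℝ} {T : Finset ι}
    (hF : DependsOn F (T : Set ι)ᶜ) : DependsOn (coordMean ν k F) (↑(insert k T) : Set ι)ᶜ := by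
  intro x y hxy
  unfold coordMean
  congr 1
  ext z
  refine hF fun i hi => ?_
  rcases eq_or_ne i k with rfl | hik
  · simp
  · simp only [Function.update_of_ne hik]
    exact hxy i (by simpa [hik] using hi)

section Probability

variable [∀ i, IsProbabilityMeasure (ν i)]

lemma measurable_coordMean (k : ι) {F : (∀ i, E i) → ℝ} (hF : Measurable F) :
    Measurable (coordMean ν k F) := by
  have : Measurable (Function.uncurry fun (x : ∀ i, E i) (y : E k) => F (Function.update x k y)) :=
    hF.comp measurable_update'
  exact this.stronglyMeasurable.integral_prod_right.measurable

lemma coordMean_mem_Icc (k : ι) {F : (∀ i, E i) → ℝ} {a b : ℝ} (hF : Measurable F)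
    (h : ∀ x, F x ∈ Set.Icc a b) (x : ∀ i, E i) : coordMean ν k F x ∈ Set.Icc a b :=
  integral_mem_Icc (hF.comp (measurable_update x)) fun _ => h _

variable [Fintype ι]

/-- Resampling one coordinate independently leaves a product law unchanged; hence averaging over
that coordinate preserves integrals. -/
lemma measurePreserving_update (k : ι) :
    MeasurePreserving (fun p : (∀ i, E i) × E k => Function.update p.1 k p.2)
      ((Measure.pi ν).prod (ν k)) (Measure.pi ν) := by
  refine ⟨measurable_update', ?_⟩
  symm
  refine Measure.pi_eq fun s hs => ?_
  rw [Measure.map_apply measurable_update' (MeasurableSet.univ_pi hs)]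
  have : (fun p : (∀ i, E i) × E k => Function.update p.1 k p.2) ⁻¹' Set.univ.pi s =
      (Set.univ.pi (Function.update s k Set.univ)) ×ˢ s k := by
    ext ⟨x, y⟩
    simp only [Set.mem_preimage, Set.mem_pi, Set.mem_univ, true_implies, Set.mem_prod]
    constructor
    · intro h
      refine ⟨fun i => ?_, by simpa using h k⟩
      rcases eq_or_ne i k with rfl | hi
      · simp
      · simpa [hi] using h i
    · rintro ⟨h, hy⟩ i
      rcases eq_or_ne i k with rfl | hi
      · simpa using hy
      · simpa [hi] using h i
  rw [this, Measure.prod_prod, Measure.pi_pi, ← Finset.mul_prod_erase _ _ (Finset.mem_univ k),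
    ← Finset.mul_prod_erase _ (fun i => ν i (s i)) (Finset.mem_univ k)]
  simp only [Function.update_self, measure_univ, one_mul]
  rw [mul_comm]
  congr 1
  refine Finset.prod_congr rfl fun i hi => ?_
  rw [Function.update_of_ne (Finset.ne_of_mem_erase hi)]

lemma integral_coordMean (k : ι) {F : (∀ i, E i) → ℝ} (hF : Integrable F (Measure.pi ν)) :
    ∫ x, coordMean ν k F x ∂Measure.pi ν = ∫ x, F x ∂Measure.pi ν := by
  have h := measurePreserving_update (ν := ν) k
  have hi := (h.integrable_comp hF.aestronglyMeasurable).2 hF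
  have e : ∫ x, F x ∂Measure.pi ν =
      ∫ p, F (Function.update p.1 k p.2) ∂(Measure.pi ν).prod (ν k) := by
    conv_lhs => rw [← h.map_eq]
    exact integral_map h.measurable.aemeasurable (by rw [h.map_eq]; exact hF.aestronglyMeasurable)
  exact (integral_prod _ hi).symm.trans e.symm

lemma integrable_coordMean (k : ι) {F : (∀ i, E i) → ℝ} (hF : Integrable F (Measure.pi ν)) :
    Integrable (coordMean ν k F) (Measure.pi ν) :=
  (((measurePreserving_update (ν := ν) k).integrable_comp hF.aestronglyMeasurable).2
    hF).integral_prod_left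

/-- The logarithm does not involve the coordinate k, so it passes through the averaging of the other
factor. -/
lemma integral_mul_log_coordMean (k : ι) {F G : (∀ i, E i) → ℝ} {a b : ℝ} (ha : 0 < a)
    (hF : Measurable F) (hG : Measurable G) (hFab : ∀ x, F x ∈ Set.Icc a b)
    (hGab : ∀ x, G x ∈ Set.Icc a b) :
    ∫ x, F x * Real.log (coordMean ν k G x) ∂Measure.pi ν =
      ∫ x, coordMean ν k F x * Real.log (coordMean ν k G x) ∂Measure.pi ν := by
  rw [← integral_coordMean k (integrable_mul_log ha hF (measurable_coordMean k hG) hFab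
    (coordMean_mem_Icc k hG hGab)), coordMean_mul_const_coord k F
    (H := fun x => Real.log (coordMean ν k G x)) fun x y => by rw [coordMean_update]]

/-- One step of the tensorization: averaging `G` over the coordinate `k`. -/
lemma integral_mul_log_sub_log_coordMean_le (k : ι) {F G : (∀ i, E i) → ℝ} {a b : ℝ} (ha : 0 < a)
    (hF : Measurable F) (hG : Measurable G) (hFab : ∀ x, F x ∈ Set.Icc a b)
    (hGab : ∀ x, G x ∈ Set.Icc a b) :
    ∫ x, F x * Real.log (G x) ∂Measure.pi ν -
        ∫ x, F x * Real.log (coordMean ν k G x) ∂Measure.pi ν ≤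
      ∫ x, F x * Real.log (F x) ∂Measure.pi ν -
        ∫ x, F x * Real.log (coordMean ν k F x) ∂Measure.pi ν := by
  have hRF := measurable_coordMean (ν := ν) k hF
  have hRG := measurable_coordMean (ν := ν) k hG
  have hRFab := coordMean_mem_Icc (ν := ν) k hF hFab
  have hRGab := coordMean_mem_Icc (ν := ν) k hG hGab
  have i1 := integrable_mul_log (μ := Measure.pi ν) ha hF hG hFab hGab
  have i2 := integrable_mul_log (μ := Measure.pi ν) ha hRF hRG hRFab hRGab
  have i3 := integrable_mul_log (μ := Measure.pi ν) ha hF hF hFab hFab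
  have i4 := integrable_mul_log (μ := Measure.pi ν) ha hRF hRF hRFab hRFab
  rw [integral_mul_log_coordMean k ha hF hG hFab hGab,
    integral_mul_log_coordMean k ha hF hF hFab hFab, ← integral_coordMean k i1,
    ← integral_coordMean k i3, ← integral_sub (integrable_coordMean k i1) i2,
    ← integral_sub (integrable_coordMean k i3) i4]
  refine integral_mono ((integrable_coordMean k i1).sub i2) ((integrable_coordMean k i3).sub i4)
    fun x => ?_
  have m := measurable_update x (a := k)
  exact integral_mul_log_sub_le_entropy ha (hF.comp m) (hG.comp m) (fun _ => hFab _)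
    fun _ => hGab _

/-- Tensorization of the entropy over a product probability measure. -/
theorem entropy_pi_le {F : (∀ i, E i) → ℝ} {a b : ℝ} (ha : 0 < a) (hF : Measurable F)
    (hFab : ∀ x, F x ∈ Set.Icc a b) :
    ∫ x, F x * Real.log (F x) ∂Measure.pi ν -
        (∫ x, F x ∂Measure.pi ν) * Real.log (∫ x, F x ∂Measure.pi ν) ≤
      ∑ k, (∫ x, F x * Real.log (F x) ∂Measure.pi ν -
        ∫ x, F x * Real.log (coordMean ν k F x) ∂Measure.pi ν) := by
  -- G is F averaged over the coordinates in T. It starts at F and loses one coordinate at a time;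
  -- each loss costs at most the k-th term of the sum.
  have key : ∀ T : Finset ι, ∃ G : (∀ i, E i) → ℝ, Measurable G ∧ (∀ x, G x ∈ Set.Icc a b) ∧
      DependsOn G (T : Set ι)ᶜ ∧ ∫ x, G x ∂Measure.pi ν = ∫ x, F x ∂Measure.pi ν ∧
      ∫ x, F x * Real.log (F x) ∂Measure.pi ν - ∫ x, F x * Real.log (G x) ∂Measure.pi ν ≤
      ∑ k ∈ T, (∫ x, F x * Real.log (F x) ∂Measure.pi ν -
        ∫ x, F x * Real.log (coordMean ν k F x) ∂Measure.pi ν) := by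
    intro T
    induction T using Finset.induction_on with
    | empty =>
      refine ⟨F, hF, hFab, ?_, rfl, by simp⟩
      intro x y hxy
      rw [funext fun i => hxy i (by simp)]
    | insert k T hk ih =>
      obtain ⟨G, hG, hGab, hdep, hint, hle⟩ := ih
      refine ⟨coordMean ν k G, measurable_coordMean k hG, coordMean_mem_Icc k hG hGab,
        dependsOn_coordMean k hdep, ?_, ?_⟩
      · rw [integral_coordMean k (integrable_of_mem_Icc hG hGab), hint]
      · rw [Finset.sum_insert hk]
        have := integral_mul_log_sub_log_coordMean_le (ν := ν) k ha hF hG hFab hGab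
        linarith
  obtain ⟨G, -, -, hdep, hint, hle⟩ := key Finset.univ
  obtain ⟨x₀⟩ : Nonempty (∀ i, E i) := (Measure.pi ν).nonempty_of_neZero
  -- Once all coordinates are averaged out, G is a constant, hence equal to the integral of F.
  have hc : ∀ x, G x = G x₀ := fun x => hdep fun i hi => by simp at hi
  simp only [hc, integral_const, integral_mul_const, probReal_univ, one_smul] at hint hle
  rwa [hint] at hle

end Probability

end Tensorization

/-! ### Entropy bound along one coordinate -/

lemma one_sub_sq_div_two_le {x : ℝ} (hx : 0 ≤ x) : 1 - x ^ 2 / 2 ≤ (1 + x) * Real.exp (-x) := by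
  have hd : ∀ y : ℝ, HasDerivAt (fun y => (1 + y) * Real.exp (-y) + y ^ 2 / 2)
      (y * (1 - Real.exp (-y))) y := by
    intro y
    have h1 := ((hasDerivAt_id y).const_add 1).mul (hasDerivAt_neg y).exp
    have h2 := ((hasDerivAt_id y).pow 2).div_const 2
    refine (h1.add h2).congr_deriv ?_
    simp only [id, Nat.cast_ofNat, pow_one, Nat.add_one_sub_one]
    ring
  have hmono : MonotoneOn (fun y : ℝ => (1 + y) * Real.exp (-y) + y ^ 2 / 2) (Set.Ici 0) := by
    refine monotoneOn_of_deriv_nonneg (convex_Ici 0)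
      (fun y _ => (hd y).continuousAt.continuousWithinAt)
      (fun y _ => (hd y).differentiableAt.differentiableWithinAt) fun y hy => ?_
    rw [interior_Ici, Set.mem_Ioi] at hy
    rw [(hd y).deriv]
    exact mul_nonneg hy.le (sub_nonneg.2 (Real.exp_le_one_iff.2 (by linarith)))
  have h := hmono (Set.mem_Ici.2 le_rfl) hx hx
  norm_num at h
  linarith

/-- The function `a ↦ t a exp (t a) - (1 + t) (exp (t a) - 1)` lies below its second-order Taylor
polynomial at `0` on `(-∞, 1]`. -/
lemma mul_exp_sub_le {t a : ℝ} (ht : 0 ≤ t) (ha : a ≤ 1) :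
    Real.exp (t * a) * (t * a) - (1 + t) * Real.exp (t * a) ≤
      t ^ 2 / 2 * a ^ 2 - t ^ 2 * a - (1 + t) := by
  rcases le_total 0 a with h0 | h0
  · have h := Real.quadratic_le_exp_of_nonneg (mul_nonneg ht h0)
    have h1 : 0 ≤ 1 + t * (1 - a) := by nlinarith
    have h2 := mul_le_mul_of_nonneg_left h h1
    -- Up to the factor 1/2, this is the remainder when (1 + ta + (ta)²/2)(1 + t(1 - a)) is
    -- expanded; it is where a ≤ 1 gives the sign.
    have h3 : 0 ≤ t ^ 3 * a ^ 2 * (1 - a) := by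
      have : 0 ≤ 1 - a := by linarith
      positivity
    nlinarith
  · have hx : 0 ≤ -(t * a) := by nlinarith
    have h1 := one_sub_sq_div_two_le hx
    have h2 := Real.add_one_le_exp (t * a)
    rw [neg_neg] at h1
    have h3 := mul_le_mul_of_nonneg_left h2 ht
    nlinarith

section OneCoordinate

variable {Y : Type*} [MeasurableSpace Y] {ν : Measure Y} [IsProbabilityMeasure ν]
  {u α : Y → ℝ} {a b t c : ℝ}

/-- Jensen's inequality in tangent-line form: exp (tα) ≥ 1 + tα, and α is centred. -/
lemma exp_mul_le_integral (hu : Integrable u ν) (hα : Integrable α ν)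
    (hα0 : ∫ y, α y ∂ν = 0) (hle : ∀ y, Real.exp (t * (c + α y)) ≤ u y) :
    Real.exp (t * c) ≤ ∫ y, u y ∂ν := by
  have h : ∀ y, Real.exp (t * c) * (1 + t * α y) ≤ u y := fun y => by
    refine le_trans ?_ (hle y)
    rw [mul_add t c, Real.exp_add]
    exact mul_le_mul_of_nonneg_left (by linarith [Real.add_one_le_exp (t * α y)])
      (Real.exp_pos _).le
  have i : Integrable (fun y => t * α y) ν := hα.const_mul t
  have i' : Integrable (fun y => 1 + t * α y) ν := (integrable_const 1).add i
  have := integral_mono (i'.const_mul _) hu h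
  rw [integral_const_mul, integral_add (integrable_const 1) i, integral_const_mul, hα0] at this
  simpa using this

/-- The entropy bound along one coordinate, against a single function of the class. -/
lemma entropy_le_of_exp_le (ha : 0 < a) (hu : Measurable u) (huab : ∀ y, u y ∈ Set.Icc a b)
    (hα : Measurable α) (hα1 : ∀ y, α y ∈ Set.Icc (-1 : ℝ) 1) (hα0 : ∫ y, α y ∂ν = 0)
    (ht : 0 < t) (hle : ∀ y, Real.exp (t * (c + α y)) ≤ u y)
    (hup : ∀ y, Real.log (u y) - Real.log (∫ y, u y ∂ν) ≤ t) :
    ∫ y, u y * Real.log (u y) ∂ν - (∫ y, u y ∂ν) * Real.log (∫ y, u y ∂ν) ≤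
      t * ((∫ y, u y ∂ν) *
        (Real.log (∫ y, u y ∂ν) - t * c + t / 2 * ∫ y, α y ^ 2 ∂ν)) := by
  have hui := integrable_of_mem_Icc (μ := ν) hu huab
  have hαi := integrable_of_mem_Icc (μ := ν) hα hα1
  have hα2i : Integrable (fun y => α y ^ 2) ν :=
    integrable_of_mem_Icc (a := 0) (b := 1) (hα.pow_const 2) fun y =>
      ⟨sq_nonneg _, by nlinarith [(hα1 y).1, (hα1 y).2]⟩
  have huu := integrable_mul_log (μ := ν) ha hu hu huab huab
  have hcU := exp_mul_le_integral hui hαi hα0 hle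
  have hσ : 0 ≤ ∫ y, α y ^ 2 ∂ν := integral_nonneg fun y => sq_nonneg _
  set U := ∫ y, u y ∂ν
  have hU : 0 < U := (Real.exp_pos _).trans_le hcU
  -- Split u = (u - exp (t(c + α))) + exp (t(c + α)) in front of log (u/U). The first part is
  -- nonnegative, so `hup` applies; Young's inequality for exp (tα) and u/U handles the second.
  have key : ∀ y, u y * Real.log (u y) - u y * Real.log U ≤ (t + Real.exp (t * c) / U) * u y +
      (Real.exp (t * c) * (t ^ 2 / 2) * α y ^ 2 - Real.exp (t * c) * t ^ 2 * α y -
        Real.exp (t * c) * (1 + t)) := by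
    intro y
    have huy := ha.trans_le (huab y).1
    have h1 := mul_le_mul_of_nonneg_left (hup y) (sub_nonneg.2 (hle y))
    have h2 := mul_log_le_mul_log_add (Real.exp_pos (t * α y)) (div_pos huy hU)
    rw [Real.log_div huy.ne' hU.ne', Real.log_exp] at h2
    have h3 := mul_exp_sub_le ht.le (hα1 y).2
    have h4 := mul_le_mul_of_nonneg_left (add_le_add h2 h3) (Real.exp_pos (t * c)).le
    rw [mul_add t c, Real.exp_add] at h1
    have h5 : Real.exp (t * c) / U * u y = Real.exp (t * c) * (u y / U) := by ring
    rw [add_mul, h5]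
    linarith
  have i1 : Integrable (fun y => (t + Real.exp (t * c) / U) * u y) ν := hui.const_mul _
  have i2 : Integrable (fun y => Real.exp (t * c) * (t ^ 2 / 2) * α y ^ 2) ν := hα2i.const_mul _
  have i3 : Integrable (fun y => Real.exp (t * c) * t ^ 2 * α y) ν := hαi.const_mul _
  have i4 : Integrable (fun y => u y * Real.log U) ν := hui.mul_const _
  have i5 : Integrable (fun _ : Y => Real.exp (t * c) * (1 + t)) ν := integrable_const _
  have h := integral_mono (huu.sub i4) (i1.add ((i2.sub i3).sub i5)) key
  rw [integral_sub' huu i4, integral_add' i1 ((i2.sub i3).sub i5), integral_sub' (i2.sub i3) i5,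
    integral_sub' i2 i3, integral_mul_const, integral_const_mul, integral_const_mul,
    integral_const_mul, hα0, integral_const, probReal_univ, one_smul] at h
  change _ - U * _ ≤ (t + Real.exp (t * c) / U) * U + _ at h
  have h6 : (t + Real.exp (t * c) / U) * U = t * U + Real.exp (t * c) := by field_simp
  rw [h6] at h
  -- This gives U - exp (tc) ≤ U(log U - tc), which turns the integrated term t(U - exp (tc)) into
  -- the stated bound.
  have h7 := Real.log_le_sub_one_of_pos (div_pos (Real.exp_pos (t * c)) hU)
  rw [Real.log_div (Real.exp_pos _).ne' hU.ne', Real.log_exp] at h7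
  have h8 := mul_le_mul_of_nonneg_left h7 hU.le
  have h9 : U * (Real.exp (t * c) / U - 1) = Real.exp (t * c) - U := by field_simp
  rw [h9] at h8
  have h10 := mul_le_mul_of_nonneg_left h8 ht.le
  have h11 := mul_le_mul_of_nonneg_right hcU
    (mul_nonneg (by positivity : (0 : ℝ) ≤ t ^ 2 / 2) hσ)
  nlinarith

end OneCoordinate

/-! ### Suprema of sums over coordinates -/

section Supremum

variable {ι J : Type*} [Fintype ι] {E : ι → Type*} {a : J → ∀ k, E k → ℝ}

/-- The supremum over `j` of the sums `∑ k, a j k (x k)`. -/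
noncomputable def supSum (a : J → ∀ k, E k → ℝ) (x : ∀ k, E k) : ℝ :=
  ⨆ j, ∑ k, a j k (x k)

lemma abs_sum_le_card (ha : ∀ j k y, a j k y ∈ Set.Icc (-1 : ℝ) 1) (j : J) (x : ∀ k, E k) :
    |∑ k, a j k (x k)| ≤ Fintype.card ι := by
  refine (Finset.abs_sum_le_sum_abs _ _).trans ?_
  simpa using Finset.sum_le_sum fun k (_ : k ∈ Finset.univ) => abs_le.2 (ha j k (x k))

lemma sum_le_supSum (ha : ∀ j k y, a j k y ∈ Set.Icc (-1 : ℝ) 1) (j : J) (x : ∀ k, E k) :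
    ∑ k, a j k (x k) ≤ supSum a x :=
  le_ciSup (f := fun j => ∑ k, a j k (x k))
    ⟨Fintype.card ι, by rintro _ ⟨j, rfl⟩; exact (abs_le.1 (abs_sum_le_card ha j x)).2⟩ j

lemma supSum_mem_Icc [Nonempty J] (ha : ∀ j k y, a j k y ∈ Set.Icc (-1 : ℝ) 1) (x : ∀ k, E k) :
    supSum a x ∈ Set.Icc (-(Fintype.card ι : ℝ)) (Fintype.card ι) := by
  obtain ⟨j⟩ := ‹Nonempty J›
  exact ⟨(abs_le.1 (abs_sum_le_card ha j x)).1.trans (sum_le_supSum ha j x),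
    ciSup_le fun j => (abs_le.1 (abs_sum_le_card ha j x)).2⟩

lemma exp_supSum_mem_Icc [Nonempty J] {t : ℝ} (ha : ∀ j k y, a j k y ∈ Set.Icc (-1 : ℝ) 1) (ht : 0 < t)
    (x : ∀ k, E k) : Real.exp (t * supSum a x) ∈
      Set.Icc (Real.exp (t * -(Fintype.card ι : ℝ))) (Real.exp (t * Fintype.card ι)) := by
  have h := supSum_mem_Icc ha x
  exact ⟨Real.exp_le_exp.2 (mul_le_mul_of_nonneg_left h.1 ht.le),
    Real.exp_le_exp.2 (mul_le_mul_of_nonneg_left h.2 ht.le)⟩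

lemma measurable_supSum [Countable J] [∀ k, MeasurableSpace (E k)]
    (hm : ∀ j k, Measurable (a j k)) : Measurable (supSum a) :=
  Measurable.iSup fun j =>
    Finset.measurable_fun_sum _ fun k _ => (hm j k).comp (measurable_pi_apply k)

variable [DecidableEq ι]

lemma sum_update_eq (j : J) (k : ι) (x : ∀ k, E k) (y : E k) :
    ∑ i, a j i (Function.update x k y i) = (∑ i, a j i (x i) - a j k (x k)) + a j k y := by
  rw [← Finset.add_sum_erase _ _ (Finset.mem_univ k),
    ← Finset.add_sum_erase _ (fun i => a j i (x i)) (Finset.mem_univ k),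
    Function.update_self]
  have : ∑ i ∈ Finset.univ.erase k, a j i (Function.update x k y i) =
      ∑ i ∈ Finset.univ.erase k, a j i (x i) :=
    Finset.sum_congr rfl fun i hi => by rw [Function.update_of_ne (Finset.ne_of_mem_erase hi)]
  rw [this]
  ring

lemma supSum_update_le [Nonempty J] (ha : ∀ j k y, a j k y ∈ Set.Icc (-1 : ℝ) 1) (k : ι)
    (x : ∀ k, E k) (y : E k) : supSum a (Function.update x k y) ≤ supSum a x + 2 := by
  refine ciSup_le fun j => ?_
  rw [sum_update_eq]
  linarith [sum_le_supSum ha j x, (ha j k (x k)).1, (ha j k y).2]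

end Supremum

/-! ### Entropy of the exponential of the supremum -/

section Entropy

variable {ι J : Type*} [Fintype ι] [DecidableEq ι] {E : ι → Type*} [∀ k, MeasurableSpace (E k)]
  {a : J → ∀ k, E k → ℝ} {ν : ∀ k, Measure (E k)} [∀ k, IsProbabilityMeasure (ν k)]
  [Nonempty J] [Countable J] {t V : ℝ}

/-- The entropy of `exp (t Z)` along the coordinate `k`, bounded by means of a single `j`. -/
lemma coord_entropy_le (ha : ∀ j k y, a j k y ∈ Set.Icc (-1 : ℝ) 1)
    (hm : ∀ j k, Measurable (a j k)) (h0 : ∀ j k, ∫ y, a j k y ∂ν k = 0) (ht : 0 < t)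
    {F : (∀ k, E k) → ℝ} (hF : F = fun x => Real.exp (t * supSum a x)) (j : J) (k : ι)
    (x : ∀ k, E k) :
    coordMean ν k (fun x => F x * Real.log (F x)) x -
        coordMean ν k F x * Real.log (coordMean ν k F x) ≤
      t * Real.exp (2 * t) * F x * (Real.log (coordMean ν k F x) -
        t * (∑ i, a j i (x i) - a j k (x k)) + t / 2 * ∫ y, a j k y ^ 2 ∂ν k) := by
  have hFm : Measurable F := by
    rw [hF]; exact ((measurable_supSum hm).const_mul t).exp
  have hFab := exp_supSum_mem_Icc ha ht
  simp only [← congrFun hF] at hFab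
  have hu : Measurable fun y => F (Function.update x k y) := hFm.comp (measurable_update x)
  have hui := integrable_of_mem_Icc (μ := ν k) hu fun y => hFab _
  have hle : ∀ j y, Real.exp (t * ((∑ i, a j i (x i) - a j k (x k)) + a j k y)) ≤
      F (Function.update x k y) := fun j y => by
    rw [← sum_update_eq, hF]
    exact Real.exp_le_exp.2 (mul_le_mul_of_nonneg_left (sum_le_supSum ha j _) ht.le)
  have hc : ∀ j, t * (∑ i, a j i (x i) - a j k (x k)) ≤ Real.log (coordMean ν k F x) := fun j => by
    have := exp_mul_le_integral hui (integrable_of_mem_Icc (hm j k) (ha j k)) (h0 j k) (hle j)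
    exact (Real.le_log_iff_exp_le ((Real.exp_pos _).trans_le this)).2 this
  have hlogF : ∀ x, Real.log (F x) = t * supSum a x := fun x => by rw [hF, Real.log_exp]
  -- By `hc` every partial sum without the term k is below log U / t, and the term k adds at most 1.
  have hup : ∀ y, Real.log (F (Function.update x k y)) - Real.log (coordMean ν k F x) ≤ t := by
    intro y
    rw [hlogF, sub_le_iff_le_add, ← le_div_iff₀' ht]
    refine ciSup_le fun i => ?_
    rw [sum_update_eq, le_div_iff₀' ht, mul_add]
    nlinarith [hc i, (ha i k y).2]
  refine (entropy_le_of_exp_le (Real.exp_pos _) hu (fun y => hFab _) (hm j k) (ha j k) (h0 j k) ht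
    (hle j) hup).trans ?_
  have hσ : 0 ≤ ∫ y, a j k y ^ 2 ∂ν k := integral_nonneg fun y => sq_nonneg _
  have hB : 0 ≤ Real.log (coordMean ν k F x) -
      t * (∑ i, a j i (x i) - a j k (x k)) + t / 2 * ∫ y, a j k y ^ 2 ∂ν k :=
    add_nonneg (sub_nonneg.2 (hc j)) (by positivity)
  -- The mean gives way to F x so that all coordinates share one factor and j can later depend on
  -- the whole point x. This needs the bracket to be nonnegative, which is `hB`.
  have hU : coordMean ν k F x ≤ Real.exp (2 * t) * F x := by
    refine (integral_mono hui (integrable_const (Real.exp (2 * t) * F x)) fun y => ?_).trans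
      (by simp)
    rw [hF]
    simp only [← Real.exp_add]
    refine Real.exp_le_exp.2 ?_
    nlinarith [supSum_update_le ha k x y]
  have := mul_le_mul_of_nonneg_left (mul_le_mul_of_nonneg_right hU hB) ht.le
  refine this.trans (le_of_eq ?_)
  ring

lemma sum_coord_entropy_le (ha : ∀ j k y, a j k y ∈ Set.Icc (-1 : ℝ) 1)
    (hm : ∀ j k, Measurable (a j k)) (h0 : ∀ j k, ∫ y, a j k y ∂ν k = 0)
    (hV : ∀ j, ∑ k, ∫ y, a j k y ^ 2 ∂ν k ≤ V) (ht : 0 < t)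
    {F : (∀ k, E k) → ℝ} (hF : F = fun x => Real.exp (t * supSum a x)) (x : ∀ k, E k) :
    ∑ k, (coordMean ν k (fun x => F x * Real.log (F x)) x -
        coordMean ν k F x * Real.log (coordMean ν k F x)) ≤
      t * Real.exp (2 * t) * (F x * Real.log (F x) + t / 2 * V * F x -
        ∑ k, (F x * Real.log (F x) - F x * Real.log (coordMean ν k F x))) := by
  have hFx : 0 < F x := by rw [hF]; exact Real.exp_pos _
  have hlogF : Real.log (F x) = t * supSum a x := by rw [hF, Real.log_exp]
  set C := t * Real.exp (2 * t) * F x * (t * Fintype.card ι)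
  have hC : 0 ≤ C := by positivity
  -- The supremum need not be attained, so j is an ε-maximizer. The error is Cε, and dividing δ by C
  -- + 1 rather than C covers C = 0, the case of no coordinates.
  refine le_of_forall_pos_le_add fun δ hδ => ?_
  obtain ⟨j, hj⟩ := exists_lt_of_lt_ciSup (f := fun j => ∑ k, a j k (x k))
    (sub_lt_self (supSum a x) (div_pos hδ (by linarith : 0 < C + 1)))
  set ε := δ / (C + 1)
  have hε : 0 < ε := div_pos hδ (by linarith)
  refine (Finset.sum_le_sum fun k _ => coord_entropy_le ha hm h0 ht hF j k x).trans ?_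
  rw [← Finset.mul_sum, Finset.sum_add_distrib, Finset.sum_sub_distrib, ← Finset.mul_sum,
    ← Finset.mul_sum, Finset.sum_sub_distrib, Finset.sum_sub_distrib, ← Finset.mul_sum, ← Finset.mul_sum]
  simp only [Finset.sum_const, Finset.card_univ, nsmul_eq_mul]
  have hCε : C * ε ≤ δ := by
    rw [mul_div_assoc', div_le_iff₀ (by linarith)]
    nlinarith
  -- Summed over the N coordinates, the truncated sums give N·S - S: the lower bound for S is used
  -- in the first term and the upper bound in the second.
  have h1 := sum_le_supSum ha j x
  have h2 : (Fintype.card ι : ℝ) * (supSum a x - ε) ≤ Fintype.card ι * ∑ i, a j i (x i) :=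
    mul_le_mul_of_nonneg_left hj.le (Nat.cast_nonneg _)
  have h3 := hV j
  have h4 : ∑ k, Real.log (coordMean ν k F x) -
      t * (Fintype.card ι * ∑ i, a j i (x i) - ∑ k, a j k (x k)) +
      t / 2 * ∑ k, ∫ y, a j k y ^ 2 ∂ν k ≤ ∑ k, Real.log (coordMean ν k F x) -
      t * (Fintype.card ι * (supSum a x - ε) - supSum a x) + t / 2 * V := by
    have := mul_le_mul_of_nonneg_left h3 (by linarith : 0 ≤ t / 2)
    have := mul_le_mul_of_nonneg_left (sub_le_sub h2 h1) ht.le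
    linarith
  have h5 := mul_le_mul_of_nonneg_left h4
    (by positivity : 0 ≤ t * Real.exp (2 * t) * F x)
  refine h5.trans ?_
  rw [hlogF]
  refine le_trans (le_of_eq ?_) (add_le_add_right hCε _)
  simp only [C]
  ring

/-- The differential inequality for the Laplace transform of `Z`, in integrated form. -/
theorem entropy_exp_supSum_le (ha : ∀ j k y, a j k y ∈ Set.Icc (-1 : ℝ) 1)
    (hm : ∀ j k, Measurable (a j k)) (h0 : ∀ j k, ∫ y, a j k y ∂ν k = 0)
    (hV : ∀ j, ∑ k, ∫ y, a j k y ^ 2 ∂ν k ≤ V) (ht : 0 < t)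
    {F : (∀ k, E k) → ℝ} (hF : F = fun x => Real.exp (t * supSum a x)) :
    ∫ x, F x * Real.log (F x) ∂Measure.pi ν -
        (∫ x, F x ∂Measure.pi ν) * Real.log (∫ x, F x ∂Measure.pi ν) ≤
      t * Real.exp (2 * t) * ((∫ x, F x ∂Measure.pi ν) * Real.log (∫ x, F x ∂Measure.pi ν) +
        t / 2 * V * ∫ x, F x ∂Measure.pi ν) := by
  have hFm : Measurable F := by
    rw [hF]; exact ((measurable_supSum hm).const_mul t).exp
  have hFab := exp_supSum_mem_Icc ha ht
  simp only [← congrFun hF] at hFab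
  have hpos := Real.exp_pos (t * -(Fintype.card ι : ℝ))
  have iF := integrable_of_mem_Icc (μ := Measure.pi ν) hFm hFab
  have iFF := integrable_mul_log (μ := Measure.pi ν) hpos hFm hFm hFab hFab
  have iFR := fun k => integrable_mul_log (μ := Measure.pi ν) hpos hFm
    (measurable_coordMean (ν := ν) k hFm) hFab (coordMean_mem_Icc k hFm hFab)
  have iRR := fun k => integrable_mul_log (μ := Measure.pi ν) hpos
    (measurable_coordMean (ν := ν) k hFm) (measurable_coordMean (ν := ν) k hFm)
    (coordMean_mem_Icc k hFm hFab) (coordMean_mem_Icc k hFm hFab)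
  have iL := fun k => integrable_coordMean (ν := ν) k iFF
  have htens := entropy_pi_le (ν := ν) hpos hFm hFab
  have h := integral_mono (μ := Measure.pi ν)
    (integrable_finsetSum Finset.univ fun k _ => (iL k).sub (iRR k))
    (((iFF.add (iF.const_mul (t / 2 * V))).sub
      (integrable_finsetSum Finset.univ fun k _ => iFF.sub (iFR k))).const_mul
        (t * Real.exp (2 * t)))
    fun x => sum_coord_entropy_le ha hm h0 hV ht hF x
  rw [integral_finsetSum _ fun k _ => (iL k).sub (iRR k), integral_const_mul,
    integral_sub' (iFF.add (iF.const_mul (t / 2 * V)))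
      (integrable_finsetSum Finset.univ fun k _ => iFF.sub (iFR k)),
    integral_add' iFF (iF.const_mul (t / 2 * V)), integral_const_mul,
    integral_finsetSum _ fun k _ => iFF.sub (iFR k)] at h
  simp only [integral_sub' iFF (iFR _), integral_sub' (iL _) (iRR _),
    integral_coordMean _ iFF] at h
  -- Each E_k F in front of its own logarithm becomes F again, so that the same sum D stands on both
  -- sides.
  simp only [← integral_mul_log_coordMean _ hpos hFm hFm hFab hFab] at h
  set D := ∑ k, (∫ x, F x * Real.log (F x) ∂Measure.pi ν -
        ∫ x, F x * Real.log (coordMean ν k F x) ∂Measure.pi ν)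
  have hp : 0 < t * Real.exp (2 * t) := by positivity
  -- Ent F ≤ D serves twice: on the left, and in -pD on the right with p = t exp (2t), where it
  -- turns ∫ F log F into (∫ F) log (∫ F).
  have h2 := mul_le_mul_of_nonneg_left htens hp.le
  linarith

end Entropy

/-! ### Integration of the differential inequality -/

open Filter Topology in
/-- Integration of the differential inequality for the log-Laplace transform. -/
lemma le_of_mul_deriv_sub_le {L L' : ℝ → ℝ} {V : ℝ} (hd : ∀ t, HasDerivAt L (L' t) t)
    (hL0 : L 0 = 0)
    (hineq : ∀ t, 0 < t → t * L' t - L t ≤ t * Real.exp (2 * t) * (L t + t / 2 * V))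
    {t : ℝ} (ht : 0 < t) :
    L t ≤ t * L' 0 + t / 2 * (2 * L' 0 + V) * (Real.exp ((Real.exp (2 * t) - 1) / 2) - 1) := by
  set e : ℝ → ℝ := fun s => Real.exp (-((Real.exp (2 * s) - 1) / 2))
  have he : ∀ s, HasDerivAt e (e s * -Real.exp (2 * s)) s := by
    intro s
    have h1 := (((((hasDerivAt_id s).const_mul 2).exp).sub_const 1).div_const 2).neg.exp
    refine h1.congr_deriv ?_
    simp only [e, id, Pi.neg_apply]
    ring
  have hψ : ∀ s, 0 < s → HasDerivAt (fun s => (L s / s + V / 2) * e s)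
      ((L' s * s - L s * 1) / s ^ 2 * e s + (L s / s + V / 2) * (e s * -Real.exp (2 * s))) s :=
    fun s hs => (((hd s).div (hasDerivAt_id s) hs.ne').add_const (V / 2)).mul (he s)
  -- The hypothesis reads (L/s)' ≤ exp (2s)(L/s + V/2), and e is its integrating factor. The value
  -- at t is then compared with the limit at 0+, where L/s tends to L'(0).
  have hanti : AntitoneOn (fun s => (L s / s + V / 2) * e s) (Set.Ioi 0) := by
    refine antitoneOn_of_deriv_nonpos (convex_Ioi 0)
      (fun s hs => (hψ s hs).continuousAt.continuousWithinAt)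
      (fun s hs => (hψ s (by simpa using hs)).differentiableAt.differentiableWithinAt)
      fun s hs => ?_
    rw [interior_Ioi, Set.mem_Ioi] at hs
    rw [(hψ s hs).deriv]
    have h1 : (L' s * s - L s * 1) / s ^ 2 ≤ (L s / s + V / 2) * Real.exp (2 * s) := by
      rw [div_le_iff₀ (by positivity)]
      have h2 : (L s / s + V / 2) * Real.exp (2 * s) * s ^ 2 =
          s * Real.exp (2 * s) * (L s + s / 2 * V) := by field_simp
      rw [h2]
      linarith [hineq s hs]
    have := mul_le_mul_of_nonneg_right h1 (Real.exp_pos _ : 0 < e s).le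
    linarith
  have hslope : Tendsto (fun s => L s / s) (𝓝[>] 0) (𝓝 (L' 0)) := by
    have h := (hasDerivAt_iff_tendsto_slope.1 (hd 0)).mono_left
      (nhdsWithin_mono 0 fun s (hs : 0 < s) => hs.ne')
    refine h.congr fun s => ?_
    rw [slope_def_field, hL0, sub_zero, sub_zero]
  have hlim : Tendsto (fun s => (L s / s + V / 2) * e s) (𝓝[>] 0) (𝓝 ((L' 0 + V / 2) * e 0)) :=
    (hslope.add_const _).mul ((he 0).continuousAt.tendsto.mono_left nhdsWithin_le_nhds)
  have h := ge_of_tendsto hlim (b := (L t / t + V / 2) * e t) (by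
    filter_upwards [Ioo_mem_nhdsGT ht] with s hs
    exact hanti hs.1 ht hs.2.le)
  have e0 : e 0 = 1 := by simp [e]
  set G := Real.exp ((Real.exp (2 * t) - 1) / 2)
  have het : e t * G = 1 := by
    simp only [e, G, ← Real.exp_add, neg_add_cancel, Real.exp_zero]
  have h3 := mul_le_mul_of_nonneg_right h (Real.exp_pos _ : 0 < G).le
  rw [mul_assoc, het, e0, mul_one, mul_one] at h3
  have h4 := mul_le_mul_of_nonneg_left h3 ht.le
  have h5 : t * (L t / t + V / 2) = L t + t * V / 2 := by field_simp
  rw [h5] at h4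
  linarith

/-! ### Optimization of the Chernoff bound -/

section Chernoff

variable {P v x : ℝ}

/-- Compare derivatives of logarithms: that of log ((1 - s/2)/(1 - 3s/2)) is 1/((1 - s/2)(1 -
3s/2)), at least exp (s/2 + 3s/2) = exp (2s). -/
lemma exp_exp_sub_one_le {t : ℝ} (ht : 0 ≤ t) (ht' : 3 * t < 2) :
    Real.exp ((Real.exp (2 * t) - 1) / 2) - 1 ≤ 2 * t / (2 - 3 * t) := by
  have hd : ∀ s, 3 * s < 2 → HasDerivAt
      (fun s => Real.log (1 - s / 2) - Real.log (1 - 3 * s / 2) - (Real.exp (2 * s) - 1) / 2)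
      (1 / ((1 - s / 2) * (1 - 3 * s / 2)) - Real.exp (2 * s)) s := by
    intro s hs
    have p1 : 1 - s / 2 ≠ 0 := by linarith
    have p2 : 1 - 3 * s / 2 ≠ 0 := by linarith
    have h1 := (((hasDerivAt_id s).div_const 2).const_sub 1).log p1
    have h2 := ((((hasDerivAt_id s).const_mul 3).div_const 2).const_sub 1).log p2
    have h3 := ((((hasDerivAt_id s).const_mul 2).exp).sub_const 1).div_const 2
    refine ((h1.sub h2).sub h3).congr_deriv ?_
    simp only [id]
    have p3 : 2 - s ≠ 0 := by linarith
    have p4 : 2 - s * 3 ≠ 0 := by linarith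
    rw [show 1 - s / 2 = (2 - s) / 2 by ring, show 1 - 3 * s / 2 = (2 - s * 3) / 2 by ring]
    field_simp
    ring
  have hmono : MonotoneOn
      (fun s => Real.log (1 - s / 2) - Real.log (1 - 3 * s / 2) - (Real.exp (2 * s) - 1) / 2)
      (Set.Icc 0 t) := by
    refine monotoneOn_of_deriv_nonneg (convex_Icc 0 t)
      (fun s hs => (hd s (by linarith [hs.2])).continuousAt.continuousWithinAt)
      (fun s hs => (hd s ?_).differentiableAt.differentiableWithinAt) fun s hs => ?_
    · rw [interior_Icc] at hs
      linarith [hs.2]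
    · rw [interior_Icc] at hs
      have p2 : 0 < 1 - 3 * s / 2 := by linarith [hs.2]
      have p1 : 0 < 1 - s / 2 := by linarith [hs.1]
      rw [(hd s (by linarith [hs.2])).deriv, sub_nonneg, le_div_iff₀ (mul_pos p1 p2)]
      have q1 : 1 - s / 2 ≤ Real.exp (-(s / 2)) := by linarith [Real.add_one_le_exp (-(s / 2))]
      have q2 : 1 - 3 * s / 2 ≤ Real.exp (-(3 * s / 2)) := by
        linarith [Real.add_one_le_exp (-(3 * s / 2))]
      have q := mul_le_mul q1 q2 p2.le (Real.exp_pos _).le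
      rw [← Real.exp_add] at q
      refine (mul_le_mul_of_nonneg_left q (Real.exp_pos _).le).trans (le_of_eq ?_)
      rw [← Real.exp_add, Real.exp_eq_one_iff]
      ring
  have h := hmono (Set.left_mem_Icc.2 ht) (Set.right_mem_Icc.2 ht) ht
  have p1 : 0 < 1 - t / 2 := by linarith
  have p2 : 0 < 1 - 3 * t / 2 := by linarith
  norm_num at h
  rw [← Real.log_div p1.ne' p2.ne', Real.le_log_iff_exp_le (div_pos p1 p2)] at h
  have h2 : (1 - t / 2) / (1 - 3 * t / 2) = 1 + 2 * t / (2 - 3 * t) := by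
    have p4 : 2 - t * 3 ≠ 0 := by linarith
    rw [show 1 - 3 * t / 2 = (2 - t * 3) / 2 by ring, show 2 - 3 * t = 2 - t * 3 by ring]
    field_simp
    ring
  linarith

/-- Serves v = 0, where the Chernoff exponent is linear in t and t can tend to infinity. -/
lemma eq_zero_of_forall_le_exp (hP0 : 0 ≤ P) (hx : 0 < x)
    (hP : ∀ t, 0 < t → P ≤ Real.exp (-(t * x))) : P = 0 := by
  refine le_antisymm ?_ hP0
  have hlim : Filter.Tendsto (fun t => Real.exp (-(t * x))) Filter.atTop (nhds 0) :=
    Real.tendsto_exp_neg_atTop_nhds_zero.comp (Filter.tendsto_id.atTop_mul_const hx)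
  exact ge_of_tendsto hlim (Filter.eventually_atTop.2 ⟨1, fun t ht => hP t (by linarith)⟩)

lemma le_exp_log_log (hv : 0 < v) (hx : 0 < x)
    (hP : ∀ t, 0 < t →
      P ≤ Real.exp (-(t * x) + t / 2 * v * (Real.exp ((Real.exp (2 * t) - 1) / 2) - 1))) :
    P ≤ Real.exp (-(x / 4 * Real.log (1 + 2 * Real.log (1 + x / v)))) := by
  have h1 : 0 < Real.log (1 + x / v) := Real.log_pos (by linarith [div_pos hx hv])
  have h2 : 0 < Real.log (1 + 2 * Real.log (1 + x / v)) := Real.log_pos (by linarith)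
  -- This t makes the double exponential equal to 1 + x/v, so the positive term is tx/2 and the
  -- exponent is -tx/2.
  refine (hP (Real.log (1 + 2 * Real.log (1 + x / v)) / 2) (by linarith)).trans (le_of_eq ?_)
  have e1 : Real.exp ((Real.exp (2 * (Real.log (1 + 2 * Real.log (1 + x / v)) / 2)) - 1) / 2) =
      1 + x / v := by
    rw [mul_div_cancel₀ _ two_ne_zero, Real.exp_log (by linarith), add_sub_cancel_left,
      mul_div_cancel_left₀ _ two_ne_zero, Real.exp_log (by linarith [div_pos hx hv])]
  rw [e1]
  congr 1
  field_simp
  ring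

lemma le_exp_bernstein (hv : 0 < v) (hx : 0 < x)
    (hP : ∀ t, 0 < t →
      P ≤ Real.exp (-(t * x) + t / 2 * v * (Real.exp ((Real.exp (2 * t) - 1) / 2) - 1))) :
    P ≤ Real.exp (-(x ^ 2 / (v + Real.sqrt (v ^ 2 + 3 * v * x) + 3 * x / 2))) := by
  obtain ⟨q, hq, hqx⟩ : ∃ q : ℝ, 1 < q ∧ q ^ 2 = 1 + 3 * x / v := by
    have : 0 < 3 * x / v := by positivity
    exact ⟨√(1 + 3 * x / v), by rw [Real.lt_sqrt] <;> linarith, Real.sq_sqrt (by linarith)⟩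
  have hxq : x = v * (q ^ 2 - 1) / 3 := by
    rw [hqx]; field_simp; ring
  have hs : Real.sqrt (v ^ 2 + 3 * v * x) = v * q := by
    rw [← Real.sqrt_sq (by positivity : 0 ≤ v * q), hxq]
    congr 1
    ring
  have hq0 : 0 < q := by linarith
  have hinv : 0 < q⁻¹ := inv_pos.2 hq0
  have hinv1 : q⁻¹ < 1 := inv_lt_one_of_one_lt₀ hq
  -- The exact minimizer of -tx + vt²/(2 - 3t), where q = √(1 + 3x/v) makes 2 - 3t = 2/q.
  have ht : 0 < 2 / 3 * (1 - q⁻¹) := by linarith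
  refine (hP _ ht).trans (Real.exp_le_exp.2 ?_)
  have h := mul_le_mul_of_nonneg_left (exp_exp_sub_one_le ht.le (by linarith))
    (by positivity : 0 ≤ 2 / 3 * (1 - q⁻¹) / 2 * v)
  rw [hs]
  refine (add_le_add_right h _).trans (le_of_eq ?_)
  have e1 : 2 - 3 * (2 / 3 * (1 - q⁻¹)) = 2 * q⁻¹ := by ring
  have e2 : v + v * q + 3 * x / 2 = v * (q + 1) ^ 2 / 2 := by rw [hxq]; ring
  rw [e1, e2, hxq]
  field_simp
  ring

lemma bernstein_le_bernstein (hv : 0 ≤ v) (hx : 0 < x) :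
    Real.exp (-(x ^ 2 / (v + Real.sqrt (v ^ 2 + 3 * v * x) + 3 * x / 2))) ≤
      Real.exp (-(x ^ 2 / (2 * v + 3 * x))) := by
  have hs : Real.sqrt (v ^ 2 + 3 * v * x) ≤ v + 3 * x / 2 := by
    rw [Real.sqrt_le_left (by linarith)]
    nlinarith [sq_nonneg x]
  refine Real.exp_le_exp.2 (neg_le_neg (div_le_div_of_nonneg_left (sq_nonneg x) ?_ ?_))
  · have := Real.sqrt_nonneg (v ^ 2 + 3 * v * x)
    linarith
  · linarith

end Chernoff

/-! ### Transfer to the empirical process -/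

section Maximum

variable {Ω 𝒳 : Type*} {n : ℕ} {X : Fin n → Ω → 𝒳} {S : Set (𝒳 → Fin n → ℝ)}

/-- The class of functions as a family of coordinate functions. -/
def coordFamily (S : Set (𝒳 → Fin n → ℝ)) (s : S) (k : Fin n) (y : 𝒳) : ℝ := s.1 y k

lemma maximum_eq_supSum (ω : Ω) : maximum X S ω = supSum (coordFamily S) fun k => X k ω := rfl

lemma maximum_mem_Icc (hne : S.Nonempty)
    (hrange : ∀ s ∈ S, ∀ x k, s x k ∈ Set.Icc (-1 : ℝ) 1) (ω : Ω) :
    maximum X S ω ∈ Set.Icc (-(n : ℝ)) n := by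
  have := hne.to_subtype
  simpa [maximum_eq_supSum] using supSum_mem_Icc (a := coordFamily S) (fun s k y => hrange s.1 s.2 y k)
    fun k => X k ω

variable [MeasurableSpace Ω] {μ : Measure Ω} [IsProbabilityMeasure μ] [MeasurableSpace 𝒳]

lemma measurable_partialSum (hX : ∀ k, Measurable (X k)) {s : 𝒳 → Fin n → ℝ} (hs : Measurable s) :
    Measurable (partialSum X s) :=
  Finset.measurable_fun_sum _ fun k _ => (measurable_pi_apply k).comp (hs.comp (hX k))

lemma integral_partialSum (hX : ∀ k, Measurable (X k)) {s : 𝒳 → Fin n → ℝ} (hs : Measurable s)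
    (hr : ∀ x k, s x k ∈ Set.Icc (-1 : ℝ) 1) (h0 : ∀ k, ∫ ω, s (X k ω) k ∂μ = 0) :
    ∫ ω, partialSum X s ω ∂μ = 0 := by
  unfold partialSum
  have hi : ∀ k, Integrable (fun ω => s (X k ω) k) μ := fun k => integrable_of_mem_Icc
    ((measurable_pi_apply k).comp (hs.comp (hX k))) fun ω => hr (X k ω) k
  rw [integral_finsetSum _ fun k _ => hi k]
  exact Finset.sum_eq_zero fun k _ => h0 k

/-- Independence adds the variances, and centring makes each a second moment under a marginal law,
the form needed on the product space. -/
lemma variance_partialSum (hX : ∀ k, Measurable (X k)) (hindep : iIndepFun X μ)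
    {s : 𝒳 → Fin n → ℝ} (hs : Measurable s) (hr : ∀ x k, s x k ∈ Set.Icc (-1 : ℝ) 1)
    (h0 : ∀ k, ∫ ω, s (X k ω) k ∂μ = 0) :
    Var[partialSum X s; μ] = ∑ k, ∫ y, s y k ^ 2 ∂μ.map (X k) := by
  have hsk : ∀ k, Measurable fun y => s y k := fun k => (measurable_pi_apply k).comp hs
  have hm : ∀ k, Measurable fun ω => s (X k ω) k := fun k => (hsk k).comp (hX k)
  have e : partialSum X s = ∑ k, fun ω => s (X k ω) k := by
    ext ω
    simp [partialSum]
  rw [e, IndepFun.variance_sum]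
  · refine Finset.sum_congr rfl fun k _ => ?_
    rw [variance_of_integral_eq_zero (hm k).aemeasurable (h0 k),
      integral_map (hX k).aemeasurable ((hsk k).pow_const 2).aestronglyMeasurable]
  · exact fun k _ => memLp_of_bounded (ae_of_all _ fun ω => hr (X k ω) k)
      (hm k).aestronglyMeasurable 2
  · exact fun i _ j _ hij => (hindep.comp (fun k y => s y k) hsk).indepFun hij

lemma variance_partialSum_le_maxVariance (hX : ∀ k, Measurable (X k)) (hindep : iIndepFun X μ)
    (hmeas : ∀ s ∈ S, Measurable s) (hrange : ∀ s ∈ S, ∀ x k, s x k ∈ Set.Icc (-1 : ℝ) 1)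
    (hcentred : ∀ s ∈ S, ∀ k, ∫ ω, s (X k ω) k ∂μ = 0) {s : 𝒳 → Fin n → ℝ} (hs : s ∈ S) :
    Var[partialSum X s; μ] ≤ maxVariance μ X S := by
  refine le_ciSup (f := fun s : S => Var[partialSum X s.1; μ]) ⟨n, ?_⟩ ⟨s, hs⟩
  rintro _ ⟨⟨s, hs⟩, rfl⟩
  have hp := fun k => Measure.isProbabilityMeasure_map (μ := μ) (hX k).aemeasurable
  simp only
  rw [variance_partialSum hX hindep (hmeas s hs) (hrange s hs) (hcentred s hs)]
  refine (Finset.sum_le_card_nsmul Finset.univ _ 1 fun k _ => ?_).trans (by simp)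
  refine (integral_mem_Icc (a := 0) (b := 1)
    (((measurable_pi_apply k).comp (hmeas s hs)).pow_const 2) fun y => ⟨sq_nonneg _, ?_⟩).2
  have := hrange s hs y k
  simp only [Function.comp_apply]
  nlinarith [this.1, this.2]

lemma measurable_maximum (hX : ∀ k, Measurable (X k)) (hcount : S.Countable)
    (hmeas : ∀ s ∈ S, Measurable s) : Measurable (maximum X S) := by
  have := hcount.to_subtype
  exact Measurable.iSup fun s : S => measurable_partialSum hX (hmeas s.1 s.2)

/-- Z dominates S_n(s) for any one s, and that sum is centred. -/
lemma integral_maximum_nonneg (hX : ∀ k, Measurable (X k)) (hne : S.Nonempty)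
    (hcount : S.Countable) (hmeas : ∀ s ∈ S, Measurable s)
    (hrange : ∀ s ∈ S, ∀ x k, s x k ∈ Set.Icc (-1 : ℝ) 1)
    (hcentred : ∀ s ∈ S, ∀ k, ∫ ω, s (X k ω) k ∂μ = 0) : 0 ≤ ∫ ω, maximum X S ω ∂μ := by
  obtain ⟨s, hs⟩ := hne
  rw [← integral_partialSum hX (hmeas s hs) (hrange s hs) (hcentred s hs)]
  refine integral_mono ?_ (integrable_of_mem_Icc (measurable_maximum hX hcount hmeas)
    (maximum_mem_Icc ⟨s, hs⟩ hrange)) fun ω => ?_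
  · refine integrable_of_mem_Icc (a := -(Fintype.card (Fin n) : ℝ)) (b := Fintype.card (Fin n))
      (measurable_partialSum hX (hmeas s hs)) fun ω => ?_
    exact abs_le.1 (abs_sum_le_card (a := coordFamily S) (fun s k y => hrange s.1 s.2 y k)
      ⟨s, hs⟩ fun k => X k ω)
  · exact sum_le_supSum (a := coordFamily S) (fun s k y => hrange s.1 s.2 y k) ⟨s, hs⟩
      fun k => X k ω

/-- The differential inequality for `t ↦ log E exp (t Z)`. -/
theorem mul_deriv_cgf_sub_le (hX : ∀ k, Measurable (X k)) (hindep : iIndepFun X μ)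
    (hne : S.Nonempty) (hcount : S.Countable) (hmeas : ∀ s ∈ S, Measurable s)
    (hrange : ∀ s ∈ S, ∀ x k, s x k ∈ Set.Icc (-1 : ℝ) 1)
    (hcentred : ∀ s ∈ S, ∀ k, ∫ ω, s (X k ω) k ∂μ = 0) {t : ℝ} (ht : 0 < t) :
    t * ((∫ ω, maximum X S ω * Real.exp (t * maximum X S ω) ∂μ) / mgf (maximum X S) μ t) -
        cgf (maximum X S) μ t ≤
      t * Real.exp (2 * t) * (cgf (maximum X S) μ t + t / 2 * maxVariance μ X S) := by
  have := hne.to_subtype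
  have := hcount.to_subtype
  have hp := fun k => Measure.isProbabilityMeasure_map (μ := μ) (hX k).aemeasurable
  have hsk : ∀ (s : S) k, Measurable (coordFamily S s k) :=
    fun s k => (measurable_pi_apply k).comp (hmeas s.1 s.2)
  have h := entropy_exp_supSum_le (a := coordFamily S) (ν := fun k => μ.map (X k))
    (V := maxVariance μ X S) (fun s k y => hrange s.1 s.2 y k) hsk
    (fun s k => by
      rw [integral_map (hX k).aemeasurable (hsk s k).aestronglyMeasurable]
      exact hcentred s.1 s.2 k)
    (fun s => by
      refine le_of_eq_of_le ?_
        (variance_partialSum_le_maxVariance hX hindep hmeas hrange hcentred s.2)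
      rw [variance_partialSum hX hindep (hmeas s.1 s.2) (hrange s.1 s.2) (hcentred s.1 s.2)]
      rfl)
    ht rfl
  have hZm := measurable_supSum hsk
  have hXm : Measurable fun ω k => X k ω := measurable_pi_lambda _ hX
  have hFF : Measurable fun x => Real.exp (t * supSum (coordFamily S) x) *
      Real.log (Real.exp (t * supSum (coordFamily S) x)) :=
    (hZm.const_mul t).exp.mul (hZm.const_mul t).exp.log
  -- By independence the product measure is the joint law of the X_k, so the integrals pull back to
  -- Ω.
  rw [← (iIndepFun_iff_map_fun_eq_pi_map fun k => (hX k).aemeasurable).1 hindep,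
    integral_map hXm.aemeasurable (hZm.const_mul t).exp.aestronglyMeasurable,
    integral_map hXm.aemeasurable hFF.aestronglyMeasurable] at h
  simp only [← maximum_eq_supSum, Real.log_exp] at h
  have hM : 0 < mgf (maximum X S) μ t := mgf_pos (integrable_exp_mul_of_mem_Icc
    (measurable_maximum hX hcount hmeas).aemeasurable
    (ae_of_all _ (maximum_mem_Icc hne hrange)))
  have e : ∫ ω, Real.exp (t * maximum X S ω) * (t * maximum X S ω) ∂μ =
      t * ∫ ω, maximum X S ω * Real.exp (t * maximum X S ω) ∂μ := by
    rw [← integral_const_mul]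
    congr 1
    ext ω
    ring
  rw [e] at h
  change _ - mgf (maximum X S) μ t * cgf (maximum X S) μ t ≤
    _ * (mgf (maximum X S) μ t * cgf (maximum X S) μ t + _ * mgf (maximum X S) μ t) at h
  refine le_of_mul_le_mul_left ?_ hM
  refine le_trans (le_of_eq ?_) (h.trans (le_of_eq ?_))
  · field_simp
  · ring

end Maximum

end EmpiricalProcess

/-! ### The theorem -/

open EmpiricalProcess in
theorem theorem1p1
    {Ω : Type*} [MeasurableSpace Ω] (μ : Measure Ω) [IsProbabilityMeasure μ]
    {𝒳 : Type*} [TopologicalSpace 𝒳] [PolishSpace 𝒳] [MeasurableSpace 𝒳] [BorelSpace 𝒳]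
    (n : ℕ) (X : Fin n → Ω → 𝒳) (hX : ∀ k, Measurable (X k)) (hindep : iIndepFun X μ)
    (S : Set (𝒳 → Fin n → ℝ)) (hne : S.Nonempty) (hcount : S.Countable)
    (hmeas : ∀ s ∈ S, Measurable s)
    (hrange : ∀ s ∈ S, ∀ x k, s x k ∈ Set.Icc (-1 : ℝ) 1)
    (hcentred : ∀ s ∈ S, ∀ k, ∫ ω, s (X k ω) k ∂μ = 0)
    (Z : Ω → ℝ) (hZ : Z = EmpiricalProcess.maximum X S)
    (V v : ℝ) (hV : V = EmpiricalProcess.maxVariance μ X S)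
    (hv : v = EmpiricalProcess.varianceFactor μ X S) :
    -- (a): `cgf Z μ t = log E exp (t Z)`
    (∀ t : ℝ, 0 < t →
      cgf Z μ t ≤ t * (∫ ω, Z ω ∂μ)
        + t / 2 * (2 * (∫ ω, Z ω ∂μ) + V) * (Real.exp ((Real.exp (2 * t) - 1) / 2) - 1)) ∧
    -- (b), where for `v = 0` the bound is the limit value `0`
    (∀ x : ℝ, 0 < x →
      (0 < v → μ.real {ω | (∫ ω', Z ω' ∂μ) + x ≤ Z ω} ≤
        Real.exp (-(x / 4 * Real.log (1 + 2 * Real.log (1 + x / v))))) ∧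
      (v = 0 → μ.real {ω | (∫ ω', Z ω' ∂μ) + x ≤ Z ω} = 0)) ∧
    0 ≤ v ∧
    -- (c)
    (∀ x : ℝ, 0 < x →
      μ.real {ω | (∫ ω', Z ω' ∂μ) + x ≤ Z ω} ≤
        Real.exp (-(x ^ 2 / (v + Real.sqrt (v ^ 2 + 3 * v * x) + 3 * x / 2))) ∧
      Real.exp (-(x ^ 2 / (v + Real.sqrt (v ^ 2 + 3 * v * x) + 3 * x / 2))) ≤
        Real.exp (-(x ^ 2 / (2 * v + 3 * x)))) := by
  have hZm : Measurable Z := hZ ▸ measurable_maximum hX hcount hmeas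
  have hZn : ∀ ω, Z ω ∈ Set.Icc (-(n : ℝ)) n := hZ ▸ maximum_mem_Icc hne hrange
  have hexp : ∀ t, Integrable (fun ω => Real.exp (t * Z ω)) μ := fun t =>
    integrable_exp_mul_of_mem_Icc hZm.aemeasurable (ae_of_all _ hZn)
  have huniv : integrableExpSet Z μ = Set.univ := Set.eq_univ_of_forall hexp
  have hmem : ∀ t, t ∈ interior (integrableExpSet Z μ) := fun t => by simp [huniv]
  have hd : ∀ t, HasDerivAt (cgf Z μ) ((∫ ω, Z ω * Real.exp (t * Z ω) ∂μ) / mgf Z μ t) t :=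
    fun t => by
      have h := (analyticAt_cgf (hmem t)).differentiableAt.hasDerivAt
      rwa [deriv_cgf (hmem t)] at h
  have hEV : v = 2 * (∫ ω, Z ω ∂μ) + V := by rw [hv, hV, hZ, varianceFactor]
  have hv0 : 0 ≤ v := by
    have h1 : 0 ≤ ∫ ω, Z ω ∂μ := hZ ▸ integral_maximum_nonneg hX hne hcount hmeas hrange hcentred
    have h2 : 0 ≤ V := hV ▸ Real.iSup_nonneg fun s => variance_nonneg _ _
    linarith
  have hcgf : ∀ t : ℝ, 0 < t → cgf Z μ t ≤ t * (∫ ω, Z ω ∂μ)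
      + t / 2 * (2 * (∫ ω, Z ω ∂μ) + V) * (Real.exp ((Real.exp (2 * t) - 1) / 2) - 1) := by
    intro t ht
    have h := le_of_mul_deriv_sub_le hd cgf_zero (V := V) (fun t ht => by
      rw [hZ, hV]
      exact mul_deriv_cgf_sub_le hX hindep hne hcount hmeas hrange hcentred ht) ht
    -- At t = 0 the weight exp (tZ) is 1, so the derivative of the log-Laplace transform is E(Z).
    simpa using h
  have hP : ∀ x t : ℝ, 0 < t → μ.real {ω | (∫ ω', Z ω' ∂μ) + x ≤ Z ω} ≤
      Real.exp (-(t * x) + t / 2 * v * (Real.exp ((Real.exp (2 * t) - 1) / 2) - 1)) := by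
    intro x t ht
    refine (measure_ge_le_exp_cgf _ ht.le (hexp t)).trans (Real.exp_le_exp.2 ?_)
    rw [hEV]
    linarith [hcgf t ht]
  have hzero : ∀ x : ℝ, 0 < x → v = 0 → μ.real {ω | (∫ ω', Z ω' ∂μ) + x ≤ Z ω} = 0 :=
    fun x hx h0 => eq_zero_of_forall_le_exp measureReal_nonneg hx fun t ht => by
      simpa [h0] using hP x t ht
  refine ⟨hcgf, fun x hx => ⟨fun hvpos => le_exp_log_log hvpos hx (hP x), hzero x hx⟩, hv0,
    fun x hx => ⟨?_, bernstein_le_bernstein hv0 hx⟩⟩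
  rcases hv0.eq_or_lt with h0 | hvpos
  · rw [hzero x hx h0.symm]
    exact (Real.exp_pos _).le
  · exact le_exp_bernstein hvpos hx (hP x)
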